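/- Let $Q$ be a finite set of $N$ qubits and let $G$ be an abelian group of multi-qubit Pauli operators with signs $\pm$ such that $-1\notin G$, having (up to scalars) a unique simultaneous $+1$ eigenvector; let $|\psi\rangle$ be this state, normalized. Let $A_1,A_2\subseteq Q$ be disjoint, $A=A_1\cup A_2$. For $S\subseteq Q$ let $\rho_S$ be the reduced density matrix of $|\psi\rangle$ on $S$, let $G_S\subseteq G$ be the subgroup of stabilizers supported inside $S$, and let $p_S(g)$ denote the restriction of a stabilizer $g$ to $S$ (the Hermitian Pauli operator, defined up to a sign, that agrees with $g$ on the sites of $S$ and is the identity elsewhere). All logarithms have base $2$. Put $S^{(m)}_S=(1-m)^{-1}\log\operatorname{Tr}\rho_S^m$ for real $m\ge 0$, $m\neq 1$ (powers being taken on the support of $\rho_S$, so $S^{(0)}_S=\log\operatorname{rank}\rho_S$), $S^{(1)}_S=-\operatorname{Tr}\rho_S\log\rho_S$, $I^{(m)}(A_1,A_2)=S^{(m)}_{A_1}+S^{(m)}_{A_2}-S^{(m)}_{A}$, and $\mathcal E_{\rm PT}(A_1,A_2)=\log\|\rho_A^{T_2}\|_1$, where $T_2$ is the partial transpose on $A_2$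 and $\|M\|_1=\operatorname{Tr}\sqrt{M^\dagger M}$. There is a subgroup $G_{12}$ with $G_A=G_{A_1}G_{A_2}G_{12}$ and $G_{12}\cap G_{A_1}G_{A_2}=\{1\}$, and every such $G_{12}$ has canonical generators, i.e. independent generators $$G_{12}=\langle z_1,\dots,z_r,w_1,\dots,w_s,\bar w_1,\dots,\bar w_s\rangle$$ such that each $p_{A_2}(z_i)$ commutes with all these generators, each $p_{A_2}(w_j)$ commutes with all of them except $\bar w_j$, and each $p_{A_2}(\bar w_j)$ commutes with all of them except $w_j$. For every such $G_{12}$ and every choice of canonical generators of it, $$\mathcal E_{\rm PT}(A_1,A_2)=s=\tfrac12\bigl[I^{(m)}(A_1,A_2)-r\bigr]\qquad\text{for every real } m\ge 0 .$$ -/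

import Mathlib

open scoped Kronecker

noncomputable section

/-- Computational-basis labels of a register of qubits indexed by `Q`. -/
abbrev QBasis (Q : Type*) : Type _ := Q → Fin 2

/-- Operators on the Hilbert space of the qubits in `Q`, as matrices in the computational basis. -/
abbrev QOp (Q : Type*) : Type _ := Matrix (QBasis Q) (QBasis Q) ℂ

/-- The four single-qubit Pauli labels. -/
inductive Pauli : Type
  | I
  | X
  | Y
  | Z

/-- The single-qubit Pauli matrices. -/
def Pauli.mat : Pauli → Matrix (Fin 2) (Fin 2) ℂ
  | Pauli.I => !![1, 0; 0, 1]
  | Pauli.X => !![0, 1; 1, 0]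
  | Pauli.Y => !![0, -Complex.I; Complex.I, 0]
  | Pauli.Z => !![1, 0; 0, -1]

/-- The multi-site Pauli operator `⨂_q σ_{p q}`. -/
def pauliString {Q : Type*} [Fintype Q] (p : Q → Pauli) : QOp Q :=
  Matrix.of fun x y => ∏ q, (p q).mat (x q) (y q)

/-- `g` is the Pauli operator with labels `p`, up to a sign. -/
def EqUpToSign {Q : Type*} [Fintype Q] (g : QOp Q) (p : Q → Pauli) : Prop :=
  g = pauliString p ∨ g = -pauliString p

open Classical in
/-- The Pauli labels of a signed Pauli operator (all `I` for any other operator). -/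
def pauliLabel {Q : Type*} [Fintype Q] (g : QOp Q) : Q → Pauli :=
  if h : ∃ p, EqUpToSign g p then h.choose else fun _ => Pauli.I

theorem trace_pauliString_mul {Q : Type*} [Fintype Q] [DecidableEq Q] (p p' : Q → Pauli) :
    (pauliString p * pauliString p').trace = ∏ q, ((p q).mat * (p' q).mat).trace := by
  simp only [Matrix.trace, Matrix.diag, Matrix.mul_apply, pauliString, Matrix.of_apply]
  rw [Finset.prod_univ_sum, Fintype.piFinset_univ]
  refine Finset.sum_congr rfl fun x _ => ?_
  rw [Finset.prod_univ_sum, Fintype.piFinset_univ]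
  refine Finset.sum_congr rfl fun y _ => ?_
  rw [Finset.prod_mul_distrib]

theorem Pauli.trace_mul_ne_zero_iff (a b : Pauli) : (a.mat * b.mat).trace ≠ 0 ↔ a = b := by
  cases a <;> cases b <;>
    simp [Pauli.mat, Matrix.trace_fin_two]

/-- The labels of a signed Pauli operator are unique, so `pauliLabel` is well defined. -/
theorem pauliLabel_eq {Q : Type*} [Fintype Q] {g : QOp Q} {p : Q → Pauli}
    (h : EqUpToSign g p) : pauliLabel g = p := by
  classical
  have hex : ∃ p, EqUpToSign g p := ⟨p, h⟩
  have key : ∀ p' : Q → Pauli, EqUpToSign g p' → p' = p := by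
    intro p' h'
    have hne : (pauliString p * pauliString p).trace ≠ 0 := by
      rw [trace_pauliString_mul]
      exact Finset.prod_ne_zero_iff.2 fun q _ => (Pauli.trace_mul_ne_zero_iff _ _).2 rfl
    have hne' : (pauliString p' * pauliString p).trace ≠ 0 := by
      intro h0
      apply hne
      rcases h with h | h <;> rcases h' with h' | h'
      · rwa [← h', h] at h0
      · have e : pauliString p' = -pauliString p := by rw [← h, h', neg_neg]
        rw [e, Matrix.neg_mul, Matrix.trace_neg, neg_eq_zero] at h0
        exact h0
      · have e : pauliString p' = -pauliString p := by rw [← h', h]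
        rw [e, Matrix.neg_mul, Matrix.trace_neg, neg_eq_zero] at h0
        exact h0
      · have e : pauliString p' = pauliString p := neg_injective (by rw [← h', h])
        rwa [e] at h0
    rw [trace_pauliString_mul] at hne'
    funext q
    exact (Pauli.trace_mul_ne_zero_iff _ _).1
      (Finset.prod_ne_zero_iff.1 hne' q (Finset.mem_univ q))
  unfold pauliLabel
  rw [dif_pos hex]
  exact key _ hex.choose_spec

section
variable {Q : Type*} [Fintype Q] [DecidableEq Q]

/-- The restriction `p_S(g)` of a signed Pauli operator `g` to the qubits in `S`: the Hermitian
Pauli operator that agrees with `g` on the sites of `S` and is the identity elsewhere. It is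
determined by `g` up to a sign; the sign `+` is chosen. -/
def pauliRestrict (S : Finset Q) (g : QOp Q) : QOp Q :=
  pauliString fun q => if q ∈ S then pauliLabel g q else Pauli.I

/-- The splitting of basis labels into the sites of `S` and the sites outside `S`. -/
def splitBasis (S : Finset Q) :
    QBasis Q ≃ QBasis {q // q ∈ S} × QBasis {q // q ∉ S} :=
  Equiv.piEquivPiSubtypeProd (fun q => q ∈ S) (fun _ => Fin 2)

/-- `M ↦ M ⊗ 1`, from operators on the qubits in `S` to operators on all the qubits. -/
def embedOp (S : Finset Q) : QOp {q // q ∈ S} →* QOp Q where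
  toFun M := Matrix.reindex (splitBasis S).symm (splitBasis S).symm
    (M ⊗ₖ (1 : QOp {q // q ∉ S}))
  map_one' := by simp
  map_mul' M N := by
    simp only [Matrix.reindex_apply, Equiv.symm_symm]
    rw [Matrix.submatrix_mul_equiv, ← Matrix.mul_kronecker_mul, Matrix.one_mul]

/-- The partial trace over the qubits outside `S`. -/
def partialTrace (S : Finset Q) (M : QOp Q) : QOp {q // q ∈ S} :=
  Matrix.of fun x y => ∑ z : QBasis {q // q ∉ S},
    M ((splitBasis S).symm (x, z)) ((splitBasis S).symm (y, z))

/-- The reduced density matrix `ρ_S` of the pure state `ψ`. -/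
def reducedDensity (S : Finset Q) (ψ : QBasis Q → ℂ) : QOp {q // q ∈ S} :=
  partialTrace S (Matrix.vecMulVec ψ (star ψ))

/-- The partial transpose, over the qubits in `T`, of an operator on the qubits in `S`: the row and
column labels of the sites in `T` are exchanged. -/
def partialTranspose (S T : Finset Q) (M : QOp {q // q ∈ S}) : QOp {q // q ∈ S} :=
  Matrix.of fun x y =>
    M (fun q => if q.1 ∈ T then y q else x q) (fun q => if q.1 ∈ T then x q else y q)

end

/-- The trace norm `‖M‖₁ = Tr √(Mᴴ M)`. -/
def traceNorm {n : Type*} [Fintype n] [DecidableEq n] (M : Matrix n n ℂ) : ℝ :=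
  (cfc Real.sqrt (M.conjTranspose * M)).trace.re

/-- The Rényi entropy, in bits, of a density matrix `ρ`:
`(1 - m)⁻¹ log₂ Tr ρ^m` for `m ≠ 1`, and the von Neumann entropy `-Tr ρ log₂ ρ` for `m = 1`.
The power is taken on the support of `ρ`, so that the index `m = 0` gives `log₂ (rank ρ)`. -/
def renyiEntropy {n : Type*} [Fintype n] [DecidableEq n] (m : ℝ) (ρ : Matrix n n ℂ) : ℝ :=
  if m = 1 then -(cfc (fun t : ℝ => t * Real.logb 2 t) ρ).trace.re
  else (1 - m)⁻¹ *
    Real.logb 2 (cfc (fun t : ℝ => if t = 0 then 0 else t ^ m) ρ).trace.re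

section
variable {Q : Type*} [Fintype Q] [DecidableEq Q]

/-- The Rényi mutual information `I^(m)(A₁, A₂)` of the pure state `ψ`. -/
def mutualInfo (m : ℝ) (A₁ A₂ : Finset Q) (ψ : QBasis Q → ℂ) : ℝ :=
  renyiEntropy m (reducedDensity A₁ ψ) + renyiEntropy m (reducedDensity A₂ ψ)
    - renyiEntropy m (reducedDensity (A₁ ∪ A₂) ψ)

/-- The partial-transpose negativity `log₂ ‖ρ_A^{T₂}‖₁`, with `A = A₁ ∪ A₂`. -/
def ptNegativity (A₁ A₂ : Finset Q) (ψ : QBasis Q → ℂ) : ℝ :=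
  Real.logb 2
    (traceNorm (partialTranspose (A₁ ∪ A₂) A₂ (reducedDensity (A₁ ∪ A₂) ψ)))

/-- An abelian group of Pauli operators with signs `±` that does not contain `-1`. -/
structure IsStabilizerGroup (G : Subgroup (QOp Q)ˣ) : Prop where
  signedPauli : ∀ g ∈ G, ∃ p, EqUpToSign (g : QOp Q) p
  comm : ∀ g ∈ G, ∀ h ∈ G, g * h = h * g
  neg_one_notMem : (-1 : (QOp Q)ˣ) ∉ G

/-- `ψ` is a unit vector and is, up to scalars, the unique simultaneous `+1` eigenvector of the
elements of `G`. -/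
structure IsStabilizerState (G : Subgroup (QOp Q)ˣ) (ψ : QBasis Q → ℂ) : Prop where
  norm_one : ∑ x, ‖ψ x‖ ^ 2 = 1
  fixed : ∀ g ∈ G, (g : QOp Q).mulVec ψ = ψ
  unique : ∀ φ : QBasis Q → ℂ, (∀ g ∈ G, (g : QOp Q).mulVec φ = φ) → ∃ c : ℂ, φ = c • ψ

/-- `G_S`: the subgroup of the stabilizers that lie inside `S`, i.e. are of the form `U ⊗ 1` with
`U` acting on the qubits in `S`. -/
def localStabilizers (G : Subgroup (QOp Q)ˣ) (S : Finset Q) : Subgroup (QOp Q)ˣ :=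
  G ⊓ (Units.map (embedOp S)).range

/-- `G₁₂` completes `G_{A₁}` and `G_{A₂}` to `G_A`, `A = A₁ ∪ A₂`: one has
`G_A = G_{A₁} G_{A₂} G₁₂`, and `G₁₂` is independent of `G_{A₁} G_{A₂}`. -/
structure IsCrossSubgroup (G : Subgroup (QOp Q)ˣ) (A₁ A₂ : Finset Q)
    (G₁₂ : Subgroup (QOp Q)ˣ) : Prop where
  generate : localStabilizers G A₁ ⊔ localStabilizers G A₂ ⊔ G₁₂ = localStabilizers G (A₁ ∪ A₂)
  independent : Disjoint (localStabilizers G A₁ ⊔ localStabilizers G A₂) G₁₂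

/-- `z₁, …, z_r, w₁, …, w_s, w̄₁, …, w̄_s` are canonical generators of `G₁₂` with respect to
restriction to `A₂`. The generators are independent: `G₁₂` has rank `r + 2 s`. -/
structure IsCanonicalGenerators (A₂ : Finset Q) (G₁₂ : Subgroup (QOp Q)ˣ) {r s : ℕ}
    (z : Fin r → (QOp Q)ˣ) (w wbar : Fin s → (QOp Q)ˣ) : Prop where
  generate : Subgroup.closure (Set.range z ∪ Set.range w ∪ Set.range wbar) = G₁₂
  independent : Nat.card G₁₂ = 2 ^ (r + 2 * s)
  z_comm : ∀ i, ∀ g ∈ Set.range z ∪ Set.range w ∪ Set.range wbar,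
    Commute (pauliRestrict A₂ (z i : QOp Q)) (g : QOp Q)
  w_comm : ∀ j, ∀ g ∈ Set.range z ∪ Set.range w ∪ Set.range wbar,
    Commute (pauliRestrict A₂ (w j : QOp Q)) (g : QOp Q) ↔ g ≠ wbar j
  wbar_comm : ∀ j, ∀ g ∈ Set.range z ∪ Set.range w ∪ Set.range wbar,
    Commute (pauliRestrict A₂ (wbar j : QOp Q)) (g : QOp Q) ↔ g ≠ w j

end

end

/-!
Both sides are read off the group `G_A` of stabilizers inside `A`. The projection `|ψ⟩⟨ψ|` is the
average of the stabilizers, and the partial trace kills those not supported in `S`, so `ρ_S` is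
`2 ^ (-|S|)` times the sum over `G_S`: a multiple of a projection, all of whose Rényi entropies are
`|S| - log |G_S|`. Hence `I^(m)` is `log |G₁₂| = r + 2 s`.

The partial transpose multiplies each term `g` by a sign `t g`, and `t (g h) / (t g * t h)` is the
sign `ε g h` by which `p_{A₂}(g)` and `p_{A₂}(h)` commute. In the square of `∑ t g • g`, summing the
character `ε g k` over `g` leaves only the `k` in the radical of `ε`, so this square is again a
multiple of a projection, and the trace norm is the square root of the index of the radical. The
radical contains `G_{A₁} G_{A₂}`, because all of `G` commutes, and on `G₁₂` the form consists of the
isotropic directions `z` and the `s` hyperbolic pairs `w, w̄`, which makes the index `2 ^ (2 s)`.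
-/

theorem card_sup_of_disjoint {U : Type*} [Group U] {H K : Subgroup U}
    (h : ∀ a ∈ H, ∀ b ∈ K, Commute a b) (hd : Disjoint H K) :
    Nat.card ↥(H ⊔ K) = Nat.card H * Nat.card K := by
  have hcomm : ∀ (a : H) (b : K), Commute (H.subtype a) (K.subtype b) := fun a b => h a a.2 b b.2
  have hinj := (MonoidHom.noncommCoprod_injective _ _ hcomm).2
    ⟨H.subtype_injective, K.subtype_injective, by simpa using hd⟩
  have hrange := MonoidHom.noncommCoprod_range _ _ hcomm
  rw [Subgroup.range_subtype, Subgroup.range_subtype] at hrange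
  rw [← hrange, ← Nat.card_prod, Nat.card_congr (MonoidHom.ofInjective hinj).toEquiv]

section ElementaryAbelian

open scoped IsMulCommutative

variable {L : Type*} {p : ℕ} [Fact p.Prime]

section
variable [CommGroup L]

theorem complementedLattice_subgroup_of_pow_eq_one (h : ∀ g : L, g ^ p = 1) :
    ComplementedLattice (Subgroup L) :=
  let _ : Module (ZMod p) (Additive L) := AddCommGroup.zmodModule (n := p) h
  (Subgroup.toAddSubgroup.trans (AddSubgroup.toZModSubmodule p)).complementedLattice_iff.2
    inferInstance

theorem toZModSubmodule_closure_range {ι : Type*} [Module (ZMod p) (Additive L)] (x : ι → L) :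
    AddSubgroup.toZModSubmodule p (Subgroup.closure (Set.range x)).toAddSubgroup =
      Submodule.span (ZMod p) (Set.range fun i => Additive.ofMul (x i)) := by
  rw [Subgroup.toAddSubgroup_closure]
  refine le_antisymm ?_ (Submodule.span_le.2 ?_)
  · exact AddSubgroup.closure_le (K := (Submodule.span (ZMod p) _).toAddSubgroup) |>.2
      Submodule.subset_span
  · exact AddSubgroup.subset_closure

theorem exists_closure_range_eq_top_of_pow_eq_one [Finite L] (h : ∀ g : L, g ^ p = 1) :
    ∃ (r : ℕ) (z : Fin r → L), Subgroup.closure (Set.range z) = ⊤ ∧ Nat.card L = p ^ r := by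
  let _ : Module (ZMod p) (Additive L) := AddCommGroup.zmodModule (n := p) h
  have : Module.Finite (ZMod p) (Additive L) := Module.Finite.of_finite
  let b := Module.finBasis (ZMod p) (Additive L)
  refine ⟨_, fun i => (b i).toMul, ?_, ?_⟩
  · apply (Subgroup.toAddSubgroup.trans (AddSubgroup.toZModSubmodule p)).injective
    simp [toZModSubmodule_closure_range]
  · rw [Nat.card_congr Additive.ofMul, Module.natCard_eq_pow_finrank (K := ZMod p), Nat.card_zmod]

theorem injective_of_closure_range_eq_top_of_card {ι : Type*} [Fintype ι] (h : ∀ g : L, g ^ p = 1)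
    {x : ι → L} (hx : Subgroup.closure (Set.range x) = ⊤)
    (hcard : Nat.card L = p ^ Fintype.card ι) : Function.Injective x := by
  let _ : Module (ZMod p) (Additive L) := AddCommGroup.zmodModule (n := p) h
  have : Finite L := Nat.finite_of_card_ne_zero (hcard ▸ pow_ne_zero _ (Fact.out : p.Prime).ne_zero)
  have hspan := toZModSubmodule_closure_range (p := p) x
  rw [hx, OrderIso.map_top, OrderIso.map_top] at hspan
  have hrank : Fintype.card ι = Module.finrank (ZMod p) (Additive L) := by
    rw [Nat.card_congr Additive.ofMul, Module.natCard_eq_pow_finrank (K := ZMod p),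
      Nat.card_zmod] at hcard
    exact (Nat.pow_right_injective (Fact.out : p.Prime).two_le hcard).symm
  exact (linearIndependent_of_top_le_span_of_card_eq_finrank hspan.le hrank).injective

end

theorem exists_disjoint_sup_eq_of_pow_eq_one {U : Type*} [Group U] {L K : Subgroup U}
    [IsMulCommutative L] (h : ∀ g : L, g ^ p = 1) (hK : K ≤ L) :
    ∃ H : Subgroup U, Disjoint K H ∧ K ⊔ H = L := by
  have := complementedLattice_subgroup_of_pow_eq_one h
  obtain ⟨H, hdisj, hsup⟩ := exists_isCompl (K.subgroupOf L)
  refine ⟨H.map L.subtype, ?_, ?_⟩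
  · simpa [Subgroup.map_subgroupOf_eq_of_le hK] using
      Subgroup.disjoint_map L.subtype_injective hdisj
  · rw [← Subgroup.map_subgroupOf_eq_of_le hK, ← Subgroup.map_sup, codisjoint_iff.1 hsup,
      ← MonoidHom.range_eq_map, L.range_subtype]

end ElementaryAbelian

section SignForm

variable {L : Type*} [Group L] {ε : L →* L →* ℤˣ}

theorem signForm_symm (hε : ∀ g, ε g g = 1) (g h : L) : ε g h = ε h g := by
  have key := hε (g * h)
  simp only [map_mul, MonoidHom.mul_apply, hε, one_mul, mul_one] at key
  rwa [mul_eq_one_iff_eq_inv, Int.units_inv_eq_self, eq_comm] at key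

theorem closure_le_ker_signForm (hε : ∀ g, ε g g = 1) {s : Set L} {k : L}
    (hk : ∀ x ∈ s, ε x k = 1) : Subgroup.closure s ≤ (ε k).ker :=
  (Subgroup.closure_le _).2 fun x hx => (signForm_symm hε k x).trans (hk x hx)

theorem index_ker_compl₂_comp {M : Type*} [Group M] (hε : ∀ g, ε g g = 1) {f : M →* L}
    (hf : ε.ker ⊔ f.range = ⊤) : ((ε.compl₂ f).comp f).ker.index = ε.ker.index := by
  have hker : ((ε.compl₂ f).comp f).ker = ε.ker.comap f := by
    refine le_antisymm (fun g hg => MonoidHom.ext fun h => ?_) fun g hg =>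
      MonoidHom.ext fun h => DFunLike.congr_fun hg (f h)
    have hle : ε.ker ⊔ f.range ≤ (ε (f g)).ker := by
      refine sup_le (fun k hk => ?_) ?_
      · rw [MonoidHom.mem_ker, signForm_symm hε, MonoidHom.mem_ker.1 hk, MonoidHom.one_apply]
      · rintro _ ⟨h, rfl⟩
        exact DFunLike.congr_fun hg h
    exact hle (hf ▸ Subgroup.mem_top h)
  rw [hker, Subgroup.index_comap, ← Subgroup.relIndex_sup_left, hf, Subgroup.relIndex_top_right]

/-- The values of a sign form against the members of a family. -/
def signPairing {ι : Type*} (ε : L →* L →* ℤˣ) (v : ι → L) : L →* (ι → ℤˣ) :=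
  MonoidHom.pi fun i => ε (v i)

@[simp]
theorem signPairing_apply {ι : Type*} (v : ι → L) (g : L) (i : ι) :
    signPairing ε v g i = ε (v i) g := rfl

theorem mem_ker_signPairing {ι : Type*} {v : ι → L} {g : L} :
    g ∈ (signPairing ε v).ker ↔ ∀ i, ε (v i) g = 1 := by
  simp [MonoidHom.mem_ker, funext_iff]

/-- A family of hyperbolic pairs: `v (inl j)` and `v (inr j)` are partners, and every member is
orthogonal to all the others except its partner. -/
def IsHyperbolic {ι : Type*} (ε : L →* L →* ℤˣ) (v : ι ⊕ ι → L) : Prop :=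
  ∀ i j, ε (v i) (v j) = 1 ↔ j ≠ i.swap

namespace IsHyperbolic

variable {ι : Type*} {v : ι ⊕ ι → L}

theorem map_signPairing_closure [Finite ι] (hv : IsHyperbolic ε v) :
    (Subgroup.closure (Set.range v)).map (signPairing ε v) = ⊤ := by
  classical
  have := Fintype.ofFinite ι
  refine (Subgroup.eq_top_iff' _).2 fun χ => ?_
  have hmem (i : ι ⊕ ι) (u : ℤˣ) :
      Pi.mulSingle i u ∈ (Subgroup.closure (Set.range v)).map (signPairing ε v) := by
    rcases Int.units_eq_one_or u with rfl | rfl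
    · rw [Pi.mulSingle_one]
      exact one_mem _
    refine ⟨v i.swap, Subgroup.subset_closure ⟨_, rfl⟩, funext fun j => ?_⟩
    rcases eq_or_ne j i with rfl | hji
    · rw [Pi.mulSingle_eq_same, signPairing_apply]
      exact (Int.units_eq_one_or _).resolve_left fun h => (hv _ _).1 h rfl
    · rw [Pi.mulSingle_eq_of_ne hji, signPairing_apply, hv]
      exact fun h => hji (by simpa using (congrArg Sum.swap h).symm)
  rw [← Finset.univ_prod_mulSingle χ]
  exact prod_mem fun i _ => hmem i (χ i)

theorem index_ker_signPairing [Fintype ι] (hv : IsHyperbolic ε v) :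
    (signPairing ε v).ker.index = 2 ^ (2 * Fintype.card ι) := by
  classical
  have hrange : (signPairing ε v).range = ⊤ :=
    top_le_iff.1 (hv.map_signPairing_closure.ge.trans (Subgroup.map_le_range _ _))
  simp [Subgroup.index_ker, hrange, two_mul]

theorem cons {s : ℕ} {v : Fin s ⊕ Fin s → L} (hv : IsHyperbolic ε v) (hε : ∀ g, ε g g = 1)
    {a b : L} (ha : ∀ i, ε (v i) a = 1) (hb : ∀ i, ε (v i) b = 1) (hab : ε a b ≠ 1) :
    IsHyperbolic ε
      (Sum.elim (Fin.cons a fun j => v (.inl j)) (Fin.cons b fun j => v (.inr j)) :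
        Fin (s + 1) ⊕ Fin (s + 1) → L) := by
  have ha' i : ε a (v i) = 1 := (signForm_symm hε _ _).trans (ha i)
  have hb' i : ε b (v i) = 1 := (signForm_symm hε _ _).trans (hb i)
  have hba : ε b a ≠ 1 := fun h => hab ((signForm_symm hε _ _).trans h)
  rintro (i | i) (j | j) <;> cases i using Fin.cases <;> cases j using Fin.cases <;>
    simp [ha, hb, ha', hb', hab, hba, hε, hv _ _, eq_comm]

end IsHyperbolic

/-- Starting from `g` with `ε k g ≠ 1`, the partner of `k` is found by correcting `g` by an element
of the span of `v` with the same pairings against `v`. -/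
theorem IsHyperbolic.exists_cons (hε : ∀ g, ε g g = 1) {s : ℕ} {v : Fin s ⊕ Fin s → L}
    (hv : IsHyperbolic ε v) (hmax : ¬ (signPairing ε v).ker ≤ ε.ker) :
    ∃ v' : Fin (s + 1) ⊕ Fin (s + 1) → L, IsHyperbolic ε v' := by
  obtain ⟨k, hk, hkε⟩ := SetLike.not_le_iff_exists.1 hmax
  rw [mem_ker_signPairing] at hk
  obtain ⟨g, hg⟩ : ∃ g, ε k g ≠ 1 := by
    by_contra! h
    exact hkε (MonoidHom.ext h)
  obtain ⟨c, hc, hcg⟩ : signPairing ε v g ∈ (Subgroup.closure (Set.range v)).map _ :=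
    hv.map_signPairing_closure ▸ Subgroup.mem_top _
  have hkc : ε k c = 1 := closure_le_ker_signForm hε (Set.forall_mem_range.2 hk) hc
  refine ⟨_, hv.cons hε hk (b := g * c⁻¹) (fun i => ?_) (by simpa [hkc] using hg)⟩
  have := congrFun hcg i
  simp only [signPairing_apply] at this
  rw [map_mul, map_inv, this, mul_inv_cancel]

theorem exists_isHyperbolic_ker_le [Finite L] (hε : ∀ g, ε g g = 1) :
    ∃ (s : ℕ) (v : Fin s ⊕ Fin s → L), IsHyperbolic ε v ∧ (signPairing ε v).ker ≤ ε.ker := by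
  by_contra! hmax
  have hall : ∀ s, ∃ v : Fin s ⊕ Fin s → L, IsHyperbolic ε v := by
    intro s
    induction s with
    | zero => exact ⟨isEmptyElim, isEmptyElim⟩
    | succ s ih =>
      obtain ⟨v, hv⟩ := ih
      exact hv.exists_cons hε (hmax s v hv)
  obtain ⟨v, hv⟩ := hall (Nat.card L)
  have hindex := hv.index_ker_signPairing
  have hle := Nat.le_of_dvd Nat.card_pos (signPairing ε v).ker.index_dvd_card
  rw [hindex, Fintype.card_fin] at hle
  have := Nat.lt_two_pow_self (n := 2 * Nat.card L)
  omega

namespace IsHyperbolic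

variable {ι : Type*} {v : ι ⊕ ι → L}

theorem ker_signPairing_eq (hε : ∀ g, ε g g = 1) (hmax : (signPairing ε v).ker ≤ ε.ker) :
    (signPairing ε v).ker = ε.ker := by
  refine le_antisymm hmax fun k hk => mem_ker_signPairing.2 fun i => ?_
  rw [signForm_symm hε, MonoidHom.mem_ker.1 hk, MonoidHom.one_apply]

theorem closure_sup_ker [Finite ι] (hv : IsHyperbolic ε v) (hmax : (signPairing ε v).ker ≤ ε.ker) :
    Subgroup.closure (Set.range v) ⊔ ε.ker = ⊤ := by
  refine (Subgroup.eq_top_iff' _).2 fun g => ?_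
  obtain ⟨c, hc, hcg⟩ : signPairing ε v g ∈ (Subgroup.closure (Set.range v)).map _ :=
    hv.map_signPairing_closure ▸ Subgroup.mem_top _
  rw [← mul_inv_cancel_left c g]
  exact Subgroup.mul_mem_sup hc (hmax (by simp [MonoidHom.mem_ker, hcg]))

theorem eq_one_iff (hv : IsHyperbolic ε v) (hε : ∀ g, ε g g = 1) {g : L}
    (hg : g ∈ (ε.ker : Set L) ∪ Set.range v) (i : ι ⊕ ι) :
    ε (v i) g = 1 ↔ g ≠ v i.swap := by
  have hswap : ε (v i) (v i.swap) ≠ 1 := fun h => (hv _ _).1 h rfl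
  refine ⟨?_, fun hne => ?_⟩
  · rintro h rfl
    exact hswap h
  rcases hg with hg | ⟨j, rfl⟩
  · rw [signForm_symm hε, MonoidHom.mem_ker.1 hg, MonoidHom.one_apply]
  · exact (hv i j).2 fun h => hne (h ▸ rfl)

end IsHyperbolic

end SignForm

section SignedSum

variable {L A : Type*} [Group L] [Ring A] {ε : L →* L →* ℤˣ} {t : L → ℤˣ}

theorem mul_sign_inv_mul (hε : ∀ g, ε g g = 1) (ht : ∀ g h, t (g * h) = t g * t h * ε g h)
    (g k : L) : t g * t (g⁻¹ * k) = ε g k * t k := by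
  have hεk : ε g (g⁻¹ * k) = ε g k := by rw [map_mul, map_inv, hε, inv_one, one_mul]
  have key := ht g (g⁻¹ * k)
  rw [mul_inv_cancel_left, hεk] at key
  rw [key, mul_left_comm, Int.units_mul_self, mul_one]

variable [Fintype L]

open Classical in
theorem sum_signForm_left (hε : ∀ g, ε g g = 1) (k : L) :
    ∑ g, (ε g k : ℤ) = if k ∈ ε.ker then (Nat.card L : ℤ) else 0 := by
  have key := sum_hom_units ((Units.coeHom ℤ).comp (ε k))
  have hker : (Units.coeHom ℤ).comp (ε k) = 1 ↔ k ∈ ε.ker := by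
    simp [MonoidHom.ext_iff, MonoidHom.mem_ker]
  simpa [hker, signForm_symm hε k] using key

open Classical in
/-- Collecting the products `g * h = k` leaves the character sum `∑ g, ε g k`, which vanishes unless
`k` is in the radical of `ε`. -/
theorem signedSum_mul_self (φ : L →* A) (hε : ∀ g, ε g g = 1)
    (ht : ∀ g h, t (g * h) = t g * t h * ε g h) :
    (∑ g, t g • φ g) * ∑ g, t g • φ g = Nat.card L • ∑ k with k ∈ ε.ker, t k • φ k :=
  calc (∑ g, t g • φ g) * ∑ g, t g • φ g
      = ∑ g, ∑ h, (t g * t h) • φ (g * h) := by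
        simp only [Finset.sum_mul_sum, smul_mul_smul_comm, map_mul]
    _ = ∑ g, ∑ k, (t g * t (g⁻¹ * k)) • φ k :=
        Finset.sum_congr rfl fun g _ =>
          Fintype.sum_equiv (Equiv.mulLeft g) _ _ fun h => by simp
    _ = ∑ k, (∑ g, (ε g k : ℤ)) • t k • φ k := by
        rw [Finset.sum_comm]
        simp only [mul_sign_inv_mul hε ht, mul_smul, Finset.sum_smul, Units.smul_def]
    _ = Nat.card L • ∑ k with k ∈ ε.ker, t k • φ k := by
        simp only [sum_signForm_left hε, ite_smul, zero_smul, natCast_zsmul, Finset.smul_sum,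
          Finset.sum_filter, smul_ite, smul_zero]

end SignedSum

section StarProjection

variable {n : Type*} [Fintype n] [DecidableEq n] {P M : Matrix n n ℂ}

theorem cfc_smul_of_isStarProjection (hP : IsStarProjection P) {f : ℝ → ℝ} (hf : f 0 = 0) (c : ℝ) :
    cfc f (c • P) = f c • P := by
  have hfin : (spectrum ℝ P).Finite := hP.isIdempotentElem.finite_spectrum ℝ
  rw [← cfc_comp_const_mul c f P ((hfin.image _).continuousOn f) hP.isSelfAdjoint,
    ← cfc_const_mul_id (f c) P hP.isSelfAdjoint]
  refine cfc_congr fun x hx => ?_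
  rcases hP.isIdempotentElem.spectrum_subset ℝ hx with rfl | rfl <;> simp [hf]

theorem renyiEntropy_smul_of_isStarProjection (hP : IsStarProjection P) {c : ℝ} (hc : 0 < c)
    (htr : P.trace = (c⁻¹ : ℝ)) (m : ℝ) : renyiEntropy m (c • P) = -Real.logb 2 c := by
  have htrace (y : ℝ) : (y • P).trace.re = y * c⁻¹ := by
    rw [Matrix.trace_smul, htr, Complex.real_smul, ← Complex.ofReal_mul, Complex.ofReal_re]
  unfold renyiEntropy
  split_ifs with hm
  · rw [cfc_smul_of_isStarProjection hP (by simp), htrace]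
    field_simp
  · have hm' : 1 - m ≠ 0 := sub_ne_zero.2 (Ne.symm hm)
    rw [cfc_smul_of_isStarProjection hP (by simp), htrace, if_neg hc.ne', ← Real.rpow_neg_one c,
      ← Real.rpow_add hc, Real.logb_rpow_eq_mul_logb_of_pos hc]
    field_simp
    ring

theorem traceNorm_eq_of_conjTranspose_mul_self (hP : IsStarProjection P) {c : ℝ} (hc : 0 ≤ c)
    (hM : M.conjTranspose * M = (c ^ 2) • P) : traceNorm M = c * P.trace.re := by
  rw [traceNorm, hM, cfc_smul_of_isStarProjection hP Real.sqrt_zero, Real.sqrt_sq hc,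
    Matrix.trace_smul, Complex.smul_re, smul_eq_mul]

end StarProjection

section RankOne

variable {n : Type*} [Fintype n]

theorem eq_vecMulVec_of_isHermitian {E : Matrix n n ℂ} {ψ : n → ℂ} (hE : E.IsHermitian)
    (hψ : star ψ ⬝ᵥ ψ = 1) (hEψ : E.mulVec ψ = ψ) (hrange : ∀ v, ∃ c : ℂ, E.mulVec v = c • ψ) :
    E = Matrix.vecMulVec ψ (star ψ) := by
  classical
  choose c hc using fun y => hrange (Pi.single y 1)
  have hcol : E = Matrix.vecMulVec ψ c := by
    ext x y
    simpa [mul_comm, Matrix.vecMulVec_apply] using congrFun (hc y) x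
  have hrow : E = Matrix.vecMulVec (star c) (star ψ) := by
    rw [← hE.eq, hcol, Matrix.conjTranspose_vecMulVec]
  have hcψ : star c = ψ := by
    rw [← hEψ, hrow, Matrix.vecMulVec_mulVec, hψ]
    simp
  rw [hrow, hcψ]

end RankOne

/-- A representation by Hermitian matrices in which only the identity has a nonzero trace, as is
the case for a group of signed Pauli operators that does not contain `-1`. -/
structure IsTracelessHermitian {L n : Type*} [Group L] [Fintype n] [DecidableEq n]
    (φ : L →* Matrix n n ℂ) : Prop where
  isHermitian : ∀ g, (φ g).IsHermitian
  trace_eq_zero : ∀ g ≠ 1, (φ g).trace = 0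

namespace IsTracelessHermitian

variable {L n : Type*} [Group L] [Fintype n] [DecidableEq n] {φ : L →* Matrix n n ℂ}

theorem comp_subtype (hφ : IsTracelessHermitian φ) (K : Subgroup L) :
    IsTracelessHermitian (φ.comp K.subtype) where
  isHermitian g := hφ.isHermitian g
  trace_eq_zero g hg := hφ.trace_eq_zero g (by simpa using hg)

variable [Fintype L]

theorem isHermitian_signedSum (hφ : IsTracelessHermitian φ) (t : L → ℤˣ) :
    (∑ g, t g • φ g).IsHermitian := by
  simp only [Matrix.IsHermitian, Matrix.conjTranspose_sum, Units.smul_def,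
    Matrix.conjTranspose_smul, star_trivial, (hφ.isHermitian _).eq]

theorem isStarProjection_average (hφ : IsTracelessHermitian φ) (χ : L →* ℤˣ) :
    IsStarProjection ((Nat.card L : ℝ)⁻¹ • ∑ g, χ g • φ g) where
  isIdempotentElem := by
    have hsq := signedSum_mul_self (ε := 1) (t := χ) φ (fun _ => rfl) (by simp)
    have hcard : (Nat.card L : ℝ) ≠ 0 := Nat.cast_ne_zero.2 Nat.card_pos.ne'
    simp only [MonoidHom.ker_one, Subgroup.mem_top, Finset.filter_true] at hsq
    rw [IsIdempotentElem, smul_mul_smul_comm, hsq, ← Nat.cast_smul_eq_nsmul ℝ, smul_smul,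
      inv_mul_cancel_right₀ hcard]
  isSelfAdjoint := (hφ.isHermitian_signedSum χ).smul (IsSelfAdjoint.all _)

theorem trace_average (hφ : IsTracelessHermitian φ) (χ : L →* ℤˣ) :
    ((Nat.card L : ℝ)⁻¹ • ∑ g, χ g • φ g).trace = (Fintype.card n / Nat.card L : ℝ) := by
  have hsum : (∑ g, χ g • φ g).trace = Fintype.card n := by
    rw [Matrix.trace_sum, Finset.sum_eq_single 1]
    · simp
    · intro g _ hg
      rw [Units.smul_def, Matrix.trace_smul, hφ.trace_eq_zero g hg, smul_zero]
    · simp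
  rw [Matrix.trace_smul, hsum, Complex.real_smul]
  push_cast
  ring

theorem renyiEntropy_sum [Nonempty n] (hφ : IsTracelessHermitian φ) (m : ℝ) :
    renyiEntropy m ((Fintype.card n : ℝ)⁻¹ • ∑ g, φ g) =
      Real.logb 2 (Fintype.card n / Nat.card L) := by
  have hn : (0 : ℝ) < Fintype.card n := Nat.cast_pos.2 Fintype.card_pos
  have hL : (0 : ℝ) < Nat.card L := Nat.cast_pos.2 Nat.card_pos
  have key := renyiEntropy_smul_of_isStarProjection (hφ.isStarProjection_average 1)
    (div_pos hL hn) (by rw [hφ.trace_average, inv_div]) m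
  rw [smul_smul, div_mul_eq_mul_div, mul_inv_cancel₀ hL.ne', one_div, ← Real.logb_inv, inv_div]
    at key
  simpa using key

theorem conjTranspose_signedSum_mul_self (hφ : IsTracelessHermitian φ) {ε : L →* L →* ℤˣ}
    {t : L → ℤˣ} (hε : ∀ g, ε g g = 1) (ht : ∀ g h, t (g * h) = t g * t h * ε g h)
    {χ : ε.ker →* ℤˣ} (hχ : ∀ k, χ k = t k) [Fintype ε.ker] :
    (∑ g, t g • φ g).conjTranspose * ∑ g, t g • φ g =
      (Nat.card L * Nat.card ε.ker : ℝ) • (Nat.card ε.ker : ℝ)⁻¹ • ∑ k, χ k • φ k := by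
  classical
  have hcard : (Nat.card ε.ker : ℝ) ≠ 0 := Nat.cast_ne_zero.2 Nat.card_pos.ne'
  rw [(hφ.isHermitian_signedSum t).eq, signedSum_mul_self φ hε ht, ← Nat.cast_smul_eq_nsmul ℝ,
    smul_smul, mul_inv_cancel_right₀ hcard,
    Finset.sum_subtype (F := ‹Fintype ε.ker›) _ (p := (· ∈ ε.ker)) (by simp)]
  simp only [hχ]

theorem traceNorm_signedSum [Nonempty n] (hφ : IsTracelessHermitian φ) {ε : L →* L →* ℤˣ}
    {t : L → ℤˣ} (hε : ∀ g, ε g g = 1) (ht : ∀ g h, t (g * h) = t g * t h * ε g h) :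
    traceNorm ((Fintype.card n : ℝ)⁻¹ • ∑ g, t g • φ g) = √ε.ker.index := by
  classical
  let χ : ε.ker →* ℤˣ := MonoidHom.mk' (fun k => t k) fun g h => by
    simp [ht, MonoidHom.mem_ker.1 g.2]
  have : (0 : ℝ) < Fintype.card n := Nat.cast_pos.2 Fintype.card_pos
  have hker : (0 : ℝ) < Nat.card ε.ker := Nat.cast_pos.2 Nat.card_pos
  have hcard : (Nat.card L : ℝ) = Nat.card ε.ker * ε.ker.index := by
    exact_mod_cast ε.ker.card_mul_index.symm
  have hsq : (Fintype.card n : ℝ)⁻¹ * (Fintype.card n : ℝ)⁻¹ * (Nat.card L * Nat.card ε.ker) =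
      (Nat.card ε.ker / Fintype.card n * √ε.ker.index) ^ 2 := by
    rw [hcard, mul_pow, Real.sq_sqrt (Nat.cast_nonneg _)]
    ring
  rw [traceNorm_eq_of_conjTranspose_mul_self ((hφ.comp_subtype ε.ker).isStarProjection_average χ)
    (c := Nat.card ε.ker / Fintype.card n * √ε.ker.index) (by positivity),
    (hφ.comp_subtype ε.ker).trace_average, Complex.ofReal_re]
  · field_simp
  · rw [Matrix.conjTranspose_smul, star_trivial, smul_mul_smul_comm,
      hφ.conjTranspose_signedSum_mul_self hε ht (χ := χ) fun _ => rfl, smul_smul, hsq]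
    rfl

theorem vecMulVec_eq_sum (hφ : IsTracelessHermitian φ) {ψ : n → ℂ} (hψ : star ψ ⬝ᵥ ψ = 1)
    (hfixed : ∀ g, (φ g).mulVec ψ = ψ)
    (hunique : ∀ v, (∀ g, (φ g).mulVec v = v) → ∃ c : ℂ, v = c • ψ) :
    Matrix.vecMulVec ψ (star ψ) = (Fintype.card n : ℝ)⁻¹ • ∑ g, φ g := by
  have hL : (Nat.card L : ℝ) ≠ 0 := Nat.cast_ne_zero.2 Nat.card_pos.ne'
  have hherm := (hφ.isStarProjection_average 1).isSelfAdjoint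
  have htrace := hφ.trace_average 1
  simp only [MonoidHom.one_apply, one_smul] at hherm htrace
  have habsorb (h : L) : φ h * ∑ g, φ g = ∑ g, φ g := by
    simp_rw [Finset.mul_sum, ← map_mul]
    exact Fintype.sum_equiv (Equiv.mulLeft h) _ _ fun g => rfl
  have hψψ : (Nat.card L : ℝ)⁻¹ • ∑ g, φ g = Matrix.vecMulVec ψ (star ψ) := by
    refine eq_vecMulVec_of_isHermitian hherm hψ ?_ fun v => hunique _ fun h => ?_
    · simp [Matrix.smul_mulVec, Matrix.sum_mulVec, hfixed, ← Nat.cast_smul_eq_nsmul ℝ, smul_smul]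
    · rw [Matrix.mulVec_mulVec, mul_smul_comm, habsorb]
  have hcard : (Fintype.card n : ℝ) = Nat.card L := by
    rw [hψψ, Matrix.trace_vecMulVec, dotProduct_comm, hψ] at htrace
    rw [← div_eq_one_iff_eq hL]
    exact_mod_cast htrace.symm
  rw [← hψψ, hcard]

end IsTracelessHermitian

namespace Pauli

/-- The label of the product of two Pauli matrices, whose phase is discarded. -/
def mul : Pauli → Pauli → Pauli
  | I, b => b
  | a, I => a
  | X, X => I
  | X, Y => Z
  | X, Z => Y
  | Y, X => Z
  | Y, Y => I
  | Y, Z => X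
  | Z, X => Y
  | Z, Y => X
  | Z, Z => I

/-- The Klein four-group structure on Pauli labels. -/
instance : CommGroup Pauli where
  one := I
  mul := mul
  inv a := a
  mul_assoc a b c := by cases a <;> cases b <;> cases c <;> rfl
  one_mul a := by cases a <;> rfl
  mul_one a := by cases a <;> rfl
  mul_comm a b := by cases a <;> cases b <;> rfl
  inv_mul_cancel a := by cases a <;> rfl

instance : Finite Pauli :=
  Finite.of_surjective ![I, X, Y, Z] <| by
    rintro (_ | _ | _ | _)
    exacts [⟨0, rfl⟩, ⟨1, rfl⟩, ⟨2, rfl⟩, ⟨3, rfl⟩]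

/-- The sign `c` with `a b = c b a` for single-qubit Pauli matrices. -/
def commSign : Pauli → Pauli → ℤˣ
  | I, _ => 1
  | _, I => 1
  | X, X => 1
  | Y, Y => 1
  | Z, Z => 1
  | _, _ => -1

/-- The sign by which transposition acts on a single-qubit Pauli matrix. -/
def transposeSign : Pauli → ℤˣ
  | Y => -1
  | _ => 1

theorem commSign_self (a : Pauli) : a.commSign a = 1 := by
  cases a <;> rfl

theorem commSign_one_left (a : Pauli) : commSign 1 a = 1 := by
  cases a <;> rfl

theorem commSign_mul_left (a b c : Pauli) : (a * b).commSign c = a.commSign c * b.commSign c := by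
  cases a <;> cases b <;> cases c <;> rfl

theorem commSign_mul_right (a b c : Pauli) : a.commSign (b * c) = a.commSign b * a.commSign c := by
  cases a <;> cases b <;> cases c <;> rfl

theorem transposeSign_mul (a b : Pauli) :
    (a * b).transposeSign = a.transposeSign * b.transposeSign * a.commSign b := by
  cases a <;> cases b <;> rfl

theorem mat_one : (1 : Pauli).mat = 1 := by
  ext i j
  fin_cases i <;> fin_cases j <;> rfl

theorem mat_mul_self (a : Pauli) : a.mat * a.mat = 1 := by
  cases a <;> ext i j <;> fin_cases i <;> fin_cases j <;> simp [mat]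

theorem exists_mat_mul (a b : Pauli) : ∃ c : ℂ, a.mat * b.mat = c • (a * b).mat := by
  suffices ∃ c ∈ ({1, Complex.I, -Complex.I} : Set ℂ), a.mat * b.mat = c • (a.mul b).mat from
    this.imp fun _ => And.right
  simp only [Set.mem_insert_iff, Set.mem_singleton_iff, exists_eq_or_imp, exists_eq_left]
  cases a <;> cases b <;> simp [mat, mul]

theorem mat_mul_comm (a b : Pauli) : a.mat * b.mat = a.commSign b • (b.mat * a.mat) := by
  cases a <;> cases b <;> ext i j <;> fin_cases i <;> fin_cases j <;>
    simp [mat, commSign, Units.smul_def]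

theorem star_mat_apply (a : Pauli) (i j : Fin 2) : star (a.mat j i) = a.mat i j := by
  cases a <;> fin_cases i <;> fin_cases j <;> simp [mat]

theorem mat_apply_swap (a : Pauli) (i j : Fin 2) : a.mat j i = a.transposeSign • a.mat i j := by
  cases a <;> fin_cases i <;> fin_cases j <;> simp [mat, transposeSign, Units.smul_def]

end Pauli

section Signs

variable {Q : Type*}

/-- The sign by which the restrictions to `S` of two Pauli operators commute, as a bilinear form on
the labels. -/
def commSignOn (S : Finset Q) : (Q → Pauli) →* (Q → Pauli) →* ℤˣ :=
  MonoidHom.mk' (fun p => MonoidHom.mk' (fun p' => ∏ q ∈ S, (p q).commSign (p' q)) fun p' p'' => by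
    simp only [Pi.mul_apply, Pauli.commSign_mul_right, Finset.prod_mul_distrib]) fun p p' => by
    ext p''
    simp [Pauli.commSign_mul_left, Finset.prod_mul_distrib]

/-- The sign by which the partial transpose over `S` acts on a Pauli operator. -/
def transposeSignOn (S : Finset Q) (p : Q → Pauli) : ℤˣ :=
  ∏ q ∈ S, (p q).transposeSign

theorem commSignOn_apply (S : Finset Q) (p p' : Q → Pauli) :
    commSignOn S p p' = ∏ q ∈ S, (p q).commSign (p' q) :=
  rfl

theorem commSignOn_self (S : Finset Q) (p : Q → Pauli) : commSignOn S p p = 1 :=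
  Finset.prod_eq_one fun q _ => (p q).commSign_self

theorem transposeSignOn_mul (S : Finset Q) (p p' : Q → Pauli) :
    transposeSignOn S (p * p') =
      transposeSignOn S p * transposeSignOn S p' * commSignOn S p p' := by
  simp only [transposeSignOn, commSignOn_apply, Pi.mul_apply, Pauli.transposeSign_mul,
    Finset.prod_mul_distrib]

end Signs

section PauliString

variable {Q : Type*} [Fintype Q]

/-- The tensor product of single-qubit operators. -/
noncomputable def tensorOp (M : Q → Matrix (Fin 2) (Fin 2) ℂ) : QOp Q :=
  Matrix.of fun x y => ∏ q, M q (x q) (y q)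

theorem pauliString_eq_tensorOp (p : Q → Pauli) : pauliString p = tensorOp fun q => (p q).mat :=
  rfl

theorem tensorOp_smul {R : Type*} [CommMonoid R] [MulAction R ℂ] [IsScalarTower R ℂ ℂ]
    [SMulCommClass R ℂ ℂ] (c : Q → R) (M : Q → Matrix (Fin 2) (Fin 2) ℂ) :
    tensorOp (fun q => c q • M q) = (∏ q, c q) • tensorOp M := by
  ext x y
  exact Finset.prod_smul _ c fun q => M q (x q) (y q)

theorem tensorOp_one : tensorOp (fun _ : Q => 1) = 1 := by
  ext x y
  rcases eq_or_ne x y with rfl | h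
  · simp [tensorOp]
  · obtain ⟨q, hq⟩ := Function.ne_iff.1 h
    rw [Matrix.one_apply_ne h]
    exact Finset.prod_eq_zero (Finset.mem_univ q) (Matrix.one_apply_ne hq)

theorem pauliString_one : pauliString (1 : Q → Pauli) = 1 := by
  simp only [pauliString_eq_tensorOp, Pi.one_apply, Pauli.mat_one, tensorOp_one]

theorem isHermitian_pauliString (p : Q → Pauli) : (pauliString p).IsHermitian := by
  ext x y
  simp only [pauliString, Matrix.conjTranspose_apply, Matrix.of_apply, star_prod,
    Pauli.star_mat_apply]

variable [DecidableEq Q]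

theorem tensorOp_mul (M N : Q → Matrix (Fin 2) (Fin 2) ℂ) :
    tensorOp M * tensorOp N = tensorOp fun q => M q * N q := by
  ext x y
  simp only [tensorOp, Matrix.mul_apply, Matrix.of_apply, Finset.prod_univ_sum,
    Fintype.piFinset_univ, Finset.prod_mul_distrib]

theorem pauliString_mul_self (p : Q → Pauli) : pauliString p * pauliString p = 1 := by
  simp only [pauliString_eq_tensorOp, tensorOp_mul, Pauli.mat_mul_self, tensorOp_one]

theorem exists_pauliString_mul (p p' : Q → Pauli) :
    ∃ c : ℂ, pauliString p * pauliString p' = c • pauliString (p * p') := by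
  choose c hc using fun q => (p q).exists_mat_mul (p' q)
  exact ⟨∏ q, c q, by
    simp only [pauliString_eq_tensorOp, tensorOp_mul, hc, tensorOp_smul, Pi.mul_apply]⟩

theorem trace_pauliString_mul_ne_zero_iff (p p' : Q → Pauli) :
    (pauliString p * pauliString p').trace ≠ 0 ↔ p = p' := by
  simp only [trace_pauliString_mul, Finset.prod_ne_zero_iff, Pauli.trace_mul_ne_zero_iff,
    Finset.mem_univ, true_imp_iff, funext_iff]

theorem pauliString_mul_comm (p p' : Q → Pauli) :
    pauliString p * pauliString p' =
      commSignOn Finset.univ p p' • (pauliString p' * pauliString p) := by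
  simp only [pauliString_eq_tensorOp, tensorOp_mul, fun q => (p q).mat_mul_comm (p' q),
    tensorOp_smul, commSignOn_apply]

theorem commute_pauliString_iff (p p' : Q → Pauli) :
    Commute (pauliString p) (pauliString p') ↔ commSignOn Finset.univ p p' = 1 := by
  have hunit (p : Q → Pauli) : IsUnit (pauliString p) :=
    .of_mul_eq_one _ (pauliString_mul_self p)
  have hne := ((hunit p').mul (hunit p)).ne_zero
  rw [Commute, SemiconjBy, pauliString_mul_comm]
  rcases Int.units_eq_one_or (commSignOn Finset.univ p p') with h | h
  · simp [h]
  · simp [h, Units.neg_smul, neg_eq_iff_add_eq_zero, ← two_smul ℂ, hne]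

end PauliString

section EqUpToSign

variable {Q : Type*} [Fintype Q] {g h : QOp Q} {p p' p'' : Q → Pauli}

theorem EqUpToSign.exists_sign (hg : EqUpToSign g p) : ∃ u : ℤˣ, g = u • pauliString p :=
  hg.elim (fun h => ⟨1, by rw [h, one_smul]⟩) fun h => ⟨-1, by rw [h, Units.neg_smul, one_smul]⟩

theorem EqUpToSign.isHermitian (hg : EqUpToSign g p) : g.IsHermitian := by
  rcases hg with rfl | rfl
  exacts [isHermitian_pauliString p, (isHermitian_pauliString p).neg]

variable [DecidableEq Q]

theorem EqUpToSign.mul_self (hg : EqUpToSign g p) : g * g = 1 := by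
  rcases hg with rfl | rfl <;> simp [pauliString_mul_self]

theorem EqUpToSign.eq_mul (hg : EqUpToSign g p) (hh : EqUpToSign h p')
    (hgh : EqUpToSign (g * h) p'') : p'' = p * p' := by
  obtain ⟨a, rfl⟩ := hg.exists_sign
  obtain ⟨b, rfl⟩ := hh.exists_sign
  obtain ⟨c, hc⟩ := exists_pauliString_mul p p'
  have hone := hgh.mul_self
  obtain ⟨u, hu⟩ := hgh.exists_sign
  rw [← trace_pauliString_mul_ne_zero_iff]
  intro htr
  have hone' : (1 : QOp Q).trace = 0 := by
    rw [← hone]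
    nth_rewrite 1 [hu]
    rw [smul_mul_smul_comm, hc, smul_mul_smul_comm, Matrix.trace_smul]
    simp [htr]
  simp at hone'

theorem EqUpToSign.commute_pauliRestrict_iff (hh : EqUpToSign h p') (S : Finset Q) (g : QOp Q) :
    Commute (pauliRestrict S g) h ↔ commSignOn S (pauliLabel g) p' = 1 := by
  have hsign : commSignOn Finset.univ (fun q => if q ∈ S then pauliLabel g q else Pauli.I) p' =
      commSignOn S (pauliLabel g) p' := by
    simp only [commSignOn_apply]
    refine (Finset.prod_subset_one_on_sdiff (Finset.subset_univ S) (fun q hq => ?_)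
      fun q hq => ?_).symm
    · simp only [if_neg (Finset.mem_sdiff.1 hq).2]
      exact Pauli.commSign_one_left _
    · simp only [if_pos hq]
  rw [pauliRestrict, ← hsign, ← commute_pauliString_iff]
  rcases hh with rfl | rfl
  exacts [Iff.rfl, Commute.neg_right_iff]

end EqUpToSign

namespace IsStabilizerGroup

variable {Q : Type*} [Fintype Q] [DecidableEq Q] {G H : Subgroup (QOp Q)ˣ}

theorem mono (hG : IsStabilizerGroup G) (hle : H ≤ G) : IsStabilizerGroup H where
  signedPauli g hg := hG.signedPauli g (hle hg)
  comm g hg h hh := hG.comm g (hle hg) h (hle hh)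
  neg_one_notMem h := hG.neg_one_notMem (hle h)

theorem isMulCommutative (hG : IsStabilizerGroup G) : IsMulCommutative G :=
  ⟨⟨fun g h => Subtype.ext (hG.comm g g.2 h h.2)⟩⟩

theorem eqUpToSign (hG : IsStabilizerGroup G) (g : G) :
    EqUpToSign (g.1 : QOp Q) (pauliLabel (g.1 : QOp Q)) := by
  obtain ⟨p, hp⟩ := hG.signedPauli g g.2
  rwa [pauliLabel_eq hp]

theorem pow_two_eq_one (hG : IsStabilizerGroup G) (g : G) : g ^ 2 = 1 := by
  ext1
  ext1
  simpa [sq] using (hG.eqUpToSign g).mul_self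

/-- The Pauli labels of the stabilizers, as a homomorphism that forgets the signs. -/
noncomputable def labelHom (hG : IsStabilizerGroup G) : G →* (Q → Pauli) :=
  MonoidHom.mk' (fun g => pauliLabel (g.1 : QOp Q)) fun g h =>
    (hG.eqUpToSign g).eq_mul (hG.eqUpToSign h) (by simpa using hG.eqUpToSign (g * h))

theorem labelHom_injective (hG : IsStabilizerGroup G) : Function.Injective hG.labelHom := by
  refine (injective_iff_map_eq_one _).2 fun g hg => ?_
  have hsign : EqUpToSign (g.1 : QOp Q) 1 := hg ▸ hG.eqUpToSign g
  rw [EqUpToSign, pauliString_one] at hsign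
  rcases hsign with h | h
  · exact Subtype.ext (Units.ext h)
  · have hneg : (g : (QOp Q)ˣ) = -1 := Units.ext h
    exact absurd (hneg ▸ g.2) hG.neg_one_notMem

theorem finite (hG : IsStabilizerGroup G) : Finite G :=
  .of_injective _ hG.labelHom_injective

theorem isTracelessHermitian (hG : IsStabilizerGroup G) :
    IsTracelessHermitian ((Units.coeHom (QOp Q)).comp G.subtype) where
  isHermitian g := (hG.eqUpToSign g).isHermitian
  trace_eq_zero g hg := by
    have htrace : (pauliString (hG.labelHom g)).trace = 0 := by
      by_contra htr
      refine hg (hG.labelHom_injective ?_)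
      rwa [map_one, ← trace_pauliString_mul_ne_zero_iff, pauliString_one, mul_one]
    obtain ⟨u, hu⟩ := (hG.eqUpToSign g).exists_sign
    change (g.1 : QOp Q).trace = 0
    rw [hu, Units.smul_def, Matrix.trace_smul]
    exact (congrArg _ htrace).trans (smul_zero _)

/-- The commutation form of the stabilizers restricted to `S`: the sign by which `p_S(g)` and
`p_S(h)` commute. -/
noncomputable def commForm (hG : IsStabilizerGroup G) (S : Finset Q) : G →* G →* ℤˣ :=
  ((commSignOn S).compl₂ hG.labelHom).comp hG.labelHom

theorem commForm_apply (hG : IsStabilizerGroup G) (S : Finset Q) (g h : G) :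
    hG.commForm S g h = commSignOn S (pauliLabel (g.1 : QOp Q)) (pauliLabel (h.1 : QOp Q)) :=
  rfl

theorem commForm_self (hG : IsStabilizerGroup G) (S : Finset Q) (g : G) :
    hG.commForm S g g = 1 :=
  commSignOn_self S _

theorem commute_pauliRestrict_iff (hG : IsStabilizerGroup G) (S : Finset Q) (g h : G) :
    Commute (pauliRestrict S (g.1 : QOp Q)) (h.1 : QOp Q) ↔ hG.commForm S g h = 1 :=
  (hG.eqUpToSign h).commute_pauliRestrict_iff S g.1

end IsStabilizerGroup

section LocalOperators

variable {Q : Type*} [DecidableEq Q] (S T : Finset Q)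

theorem partialTranspose_smul {R : Type*} [SMul R ℂ] (c : R) (M : QOp {q // q ∈ S}) :
    partialTranspose S T (c • M) = c • partialTranspose S T M :=
  rfl

theorem partialTranspose_sum {ι : Type*} (s : Finset ι) (M : ι → QOp {q // q ∈ S}) :
    partialTranspose S T (∑ i ∈ s, M i) = ∑ i ∈ s, partialTranspose S T (M i) := by
  ext x y
  simp only [partialTranspose, Matrix.of_apply, Matrix.sum_apply]

variable [Fintype Q]

theorem embedOp_apply_splitBasis (M : QOp {q // q ∈ S}) (x y : QBasis {q // q ∈ S})
    (z w : QBasis {q // q ∉ S}) :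
    embedOp S M ((splitBasis S).symm (x, z)) ((splitBasis S).symm (y, w)) =
      M x y * (1 : QOp {q // q ∉ S}) z w := by
  simp [embedOp]

theorem embedOp_smul {R : Type*} [SMul R ℂ] [IsScalarTower R ℂ ℂ] (c : R)
    (M : QOp {q // q ∈ S}) : embedOp S (c • M) = c • embedOp S M := by
  ext x y
  exact smul_mul_assoc c _ _

theorem pauliString_apply_splitBasis (p : Q → Pauli) (x y : QBasis {q // q ∈ S})
    (z w : QBasis {q // q ∉ S}) :
    pauliString p ((splitBasis S).symm (x, z)) ((splitBasis S).symm (y, w)) =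
      pauliString (fun q : {q // q ∈ S} => p q) x y *
        pauliString (fun q : {q // q ∉ S} => p q) z w := by
  simp only [pauliString, Matrix.of_apply]
  rw [← Fintype.prod_subtype_mul_prod_subtype (· ∈ S)]
  congr! 3 with q _ q _ <;> simp [splitBasis, q.2]

theorem partialTrace_smul {R : Type*} [Monoid R] [DistribMulAction R ℂ] (c : R) (M : QOp Q) :
    partialTrace S (c • M) = c • partialTrace S M := by
  ext x y
  exact Finset.smul_sum.symm

theorem partialTrace_sum {ι : Type*} (s : Finset ι) (M : ι → QOp Q) :
    partialTrace S (∑ i ∈ s, M i) = ∑ i ∈ s, partialTrace S (M i) := by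
  ext x y
  simp only [partialTrace, Matrix.of_apply, Matrix.sum_apply]
  exact Finset.sum_comm

theorem conjTranspose_partialTrace (M : QOp Q) :
    (partialTrace S M).conjTranspose = partialTrace S M.conjTranspose := by
  ext x y
  simp [partialTrace]

theorem trace_partialTrace (M : QOp Q) : (partialTrace S M).trace = M.trace := by
  simp only [Matrix.trace, Matrix.diag, partialTrace, Matrix.of_apply]
  rw [← Fintype.sum_prod_type']
  exact (splitBasis S).symm.sum_comp fun x => M x x

theorem partialTrace_embedOp (M : QOp {q // q ∈ S}) :
    partialTrace S (embedOp S M) = (2 : ℝ) ^ Fintype.card {q // q ∉ S} • M := by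
  ext x y
  simp only [partialTrace, Matrix.of_apply, embedOp_apply_splitBasis, Matrix.one_apply_eq, mul_one]
  simp

theorem embedOp_injective : Function.Injective (embedOp S) := fun M N h => by
  have htr := congrArg (partialTrace S) h
  rw [partialTrace_embedOp, partialTrace_embedOp] at htr
  exact smul_right_injective _ (pow_ne_zero _ two_ne_zero) htr

theorem units_map_embedOp_injective : Function.Injective (Units.map (embedOp S)) :=
  Units.map_injective (embedOp_injective S)

variable {S}

theorem embedOp_pauliString {p : Q → Pauli} (hp : ∀ q ∉ S, p q = 1) :
    embedOp S (pauliString fun q => p q) = pauliString p := by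
  have hone : (fun q : {q // q ∉ S} => p q) = 1 := funext fun q => hp q q.2
  ext x y
  obtain ⟨⟨x, z⟩, rfl⟩ := (splitBasis S).symm.surjective x
  obtain ⟨⟨y, w⟩, rfl⟩ := (splitBasis S).symm.surjective y
  rw [embedOp_apply_splitBasis, pauliString_apply_splitBasis, hone, pauliString_one]

theorem partialTrace_pauliString_eq_zero {p : Q → Pauli} {q : Q} (hq : q ∉ S) (hp : p q ≠ 1) :
    partialTrace S (pauliString p) = 0 := by
  have htrace : (pauliString fun q : {q // q ∉ S} => p q).trace = 0 := by
    by_contra h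
    rw [← mul_one (pauliString _), ← pauliString_one, ← ne_eq,
      trace_pauliString_mul_ne_zero_iff] at h
    exact hp (congrFun h ⟨q, hq⟩)
  ext x y
  simp only [partialTrace, Matrix.of_apply, pauliString_apply_splitBasis, ← Finset.mul_sum]
  exact (congrArg _ htrace).trans (mul_zero _)

theorem partialTranspose_partialTrace_pauliString (p : Q → Pauli) :
    partialTranspose S T (partialTrace S (pauliString p)) =
      transposeSignOn T p • partialTrace S (pauliString p) := by
  ext x y
  simp only [partialTranspose, partialTrace, Matrix.of_apply, Matrix.smul_apply, Finset.smul_sum,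
    pauliString]
  refine Finset.sum_congr rfl fun z _ => ?_
  rw [transposeSignOn, ← Fintype.prod_ite_mem T fun q => (p q).transposeSign,
    ← Finset.prod_smul]
  refine Finset.prod_congr rfl fun q _ => ?_
  by_cases hS : q ∈ S <;> by_cases hT : q ∈ T <;>
    simp [splitBasis, hS, hT, ← Pauli.mat_apply_swap]

end LocalOperators

section LocalStabilizers

variable {Q : Type*} [Fintype Q] [DecidableEq Q] {G : Subgroup (QOp Q)ˣ} {S : Finset Q}

theorem EqUpToSign.partialTrace_eq_zero {g : QOp Q} {p : Q → Pauli} (hg : EqUpToSign g p) {q : Q}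
    (hq : q ∉ S) (hp : p q ≠ 1) : partialTrace S g = 0 := by
  obtain ⟨u, rfl⟩ := hg.exists_sign
  rw [partialTrace_smul, partialTrace_pauliString_eq_zero hq hp, smul_zero]

theorem EqUpToSign.partialTranspose_partialTrace {g : QOp Q} {p : Q → Pauli}
    (hg : EqUpToSign g p) (T : Finset Q) :
    partialTranspose S T (partialTrace S g) = transposeSignOn T p • partialTrace S g := by
  obtain ⟨u, rfl⟩ := hg.exists_sign
  rw [partialTrace_smul, partialTranspose_smul, partialTranspose_partialTrace_pauliString,
    smul_comm]

theorem EqUpToSign.exists_embedOp {g : (QOp Q)ˣ} {p : Q → Pauli} (hg : EqUpToSign (g : QOp Q) p)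
    (hp : ∀ q ∉ S, p q = 1) : ∃ u, Units.map (embedOp S) u = g := by
  obtain ⟨c, hc⟩ := hg.exists_sign
  let M : QOp {q // q ∈ S} := c • pauliString fun q : {q // q ∈ S} => p q
  have hM : M * M = 1 := by
    rw [smul_mul_smul_comm, pauliString_mul_self, Int.units_mul_self, one_smul]
  refine ⟨⟨M, M, hM, hM⟩, Units.ext ?_⟩
  change embedOp S M = g
  rw [embedOp_smul, embedOp_pauliString hp, hc]

theorem localStabilizers_le (G : Subgroup (QOp Q)ˣ) (S : Finset Q) : localStabilizers G S ≤ G :=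
  inf_le_left

/-- The operator on the qubits of `S` through which a stabilizer inside `S` acts. -/
noncomputable def localPart (G : Subgroup (QOp Q)ˣ) (S : Finset Q) :
    localStabilizers G S →* QOp {q // q ∈ S} :=
  (Units.coeHom _).comp <|
    (MonoidHom.ofInjective (units_map_embedOp_injective S)).symm.toMonoidHom.comp <|
      Subgroup.inclusion inf_le_right

theorem embedOp_localPart (g : localStabilizers G S) :
    embedOp S (localPart G S g) = (g.1 : QOp Q) :=
  congrArg (fun u : (Units.map (embedOp S)).range => (u.1 : QOp Q)) <|
    (MonoidHom.ofInjective (units_map_embedOp_injective S)).apply_symm_apply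
      (Subgroup.inclusion inf_le_right g)

theorem partialTrace_localStabilizer (g : localStabilizers G S) :
    partialTrace S (g.1 : QOp Q) = (2 : ℝ) ^ Fintype.card {q // q ∉ S} • localPart G S g := by
  rw [← embedOp_localPart, partialTrace_embedOp]

theorem localPart_eq_smul_partialTrace (g : localStabilizers G S) :
    localPart G S g =
      ((2 : ℝ) ^ Fintype.card {q // q ∉ S})⁻¹ • partialTrace S (g.1 : QOp Q) := by
  rw [← embedOp_localPart, partialTrace_embedOp, inv_smul_smul₀ (pow_ne_zero _ two_ne_zero)]

namespace IsStabilizerGroup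

theorem mem_localStabilizers_iff (hG : IsStabilizerGroup G) {g : (QOp Q)ˣ} (hg : g ∈ G) :
    g ∈ localStabilizers G S ↔ ∀ q ∉ S, pauliLabel (g : QOp Q) q = 1 := by
  have hsign := hG.eqUpToSign ⟨g, hg⟩
  refine ⟨fun hgS q hq => ?_, fun h => ⟨hg, hsign.exists_embedOp h⟩⟩
  by_contra hp
  have hzero := hsign.partialTrace_eq_zero hq hp
  have hunit := (Group.isUnit (⟨g, hgS⟩ : localStabilizers G S)).map (localPart G S)
  refine hunit.ne_zero ?_
  rw [localPart_eq_smul_partialTrace, hzero, smul_zero]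

theorem isTracelessHermitian_localPart (hG : IsStabilizerGroup G) (S : Finset Q) :
    IsTracelessHermitian (localPart G S) where
  isHermitian g := by
    have hherm := (hG.mono (localStabilizers_le G S)).isTracelessHermitian.isHermitian g
    rw [Matrix.IsHermitian, localPart_eq_smul_partialTrace, Matrix.conjTranspose_smul,
      conjTranspose_partialTrace, star_trivial]
    exact congrArg (fun M => _ • partialTrace S M) hherm
  trace_eq_zero g hg := by
    have htrace := (hG.mono (localStabilizers_le G S)).isTracelessHermitian.trace_eq_zero g hg
    rw [localPart_eq_smul_partialTrace, Matrix.trace_smul, trace_partialTrace]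
    exact (congrArg _ htrace).trans (smul_zero _)

theorem partialTranspose_localPart (hG : IsStabilizerGroup G) (T : Finset Q)
    (g : localStabilizers G S) : partialTranspose S T (localPart G S g) =
      transposeSignOn T (pauliLabel (g.1 : QOp Q)) • localPart G S g := by
  have hsign := (hG.mono (localStabilizers_le G S)).eqUpToSign g
  rw [localPart_eq_smul_partialTrace, partialTranspose_smul, hsign.partialTranspose_partialTrace,
    smul_comm]

theorem partialTrace_sum_eq (hG : IsStabilizerGroup G) (S : Finset Q) [Fintype G]
    [Fintype (localStabilizers G S)] :
    partialTrace S (∑ g : G, (g.1 : QOp Q)) =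
      (2 : ℝ) ^ Fintype.card {q // q ∉ S} • ∑ g, localPart G S g := by
  rw [partialTrace_sum, Finset.smul_sum]
  symm
  refine Fintype.sum_of_injective (Subgroup.inclusion (localStabilizers_le G S))
    (Subgroup.inclusion_injective _) _ _ (fun g hg => ?_) fun g =>
      (partialTrace_localStabilizer g).symm
  obtain ⟨q, hq, hp⟩ : ∃ q ∉ S, pauliLabel (g.1 : QOp Q) q ≠ 1 := by
    by_contra! h
    exact hg ⟨⟨g, (hG.mem_localStabilizers_iff g.2).2 h⟩, rfl⟩
  exact (hG.eqUpToSign g).partialTrace_eq_zero hq hp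

end IsStabilizerGroup

end LocalStabilizers

section StabilizerState

variable {Q : Type*} [Fintype Q] [DecidableEq Q] {G : Subgroup (QOp Q)ˣ} {ψ : QBasis Q → ℂ}

namespace IsStabilizerState

theorem star_dotProduct_self (hψ : IsStabilizerState G ψ) : star ψ ⬝ᵥ ψ = 1 := by
  have hnorm := congrArg ((↑) : ℝ → ℂ) hψ.norm_one
  push_cast at hnorm
  simpa [dotProduct, Complex.conj_mul'] using hnorm

theorem reducedDensity_eq (hψ : IsStabilizerState G ψ) (hG : IsStabilizerGroup G) (S : Finset Q)
    [Fintype (localStabilizers G S)] :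
    reducedDensity S ψ =
      (Fintype.card (QBasis {q // q ∈ S}) : ℝ)⁻¹ • ∑ g, localPart G S g := by
  have := hG.finite
  have := Fintype.ofFinite G
  have hdensity := hG.isTracelessHermitian.vecMulVec_eq_sum hψ.star_dotProduct_self
    (fun g => hψ.fixed g g.2) fun v hv => hψ.unique v fun g hg => hv ⟨g, hg⟩
  have hcard : Fintype.card (QBasis Q) =
      Fintype.card (QBasis {q // q ∈ S}) * 2 ^ Fintype.card {q // q ∉ S} := by
    simpa using Fintype.card_congr (splitBasis S)
  rw [reducedDensity, hdensity, partialTrace_smul]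
  simp only [MonoidHom.comp_apply, Units.coeHom_apply, Subgroup.subtype_apply]
  rw [hG.partialTrace_sum_eq, smul_smul, hcard]
  congr 1
  push_cast
  field_simp

theorem renyiEntropy_eq (hψ : IsStabilizerState G ψ) (hG : IsStabilizerGroup G) (S : Finset Q)
    (m : ℝ) : renyiEntropy m (reducedDensity S ψ) =
      S.card - Real.logb 2 (Nat.card (localStabilizers G S)) := by
  have := (hG.mono (localStabilizers_le G S)).finite
  have := Fintype.ofFinite (localStabilizers G S)
  rw [hψ.reducedDensity_eq hG, (hG.isTracelessHermitian_localPart S).renyiEntropy_sum,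
    Real.logb_div (by simp) (Nat.cast_ne_zero.2 Nat.card_pos.ne')]
  simp [Real.logb_pow]

theorem ptNegativity_eq (hψ : IsStabilizerState G ψ) (hG : IsStabilizerGroup G)
    (A₁ A₂ : Finset Q) : ptNegativity A₁ A₂ ψ =
      Real.logb 2 ((hG.mono (localStabilizers_le G (A₁ ∪ A₂))).commForm A₂).ker.index / 2 := by
  have hL := hG.mono (localStabilizers_le G (A₁ ∪ A₂))
  have := hL.finite
  have := Fintype.ofFinite (localStabilizers G (A₁ ∪ A₂))
  rw [ptNegativity, hψ.reducedDensity_eq hG, partialTranspose_smul, partialTranspose_sum]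
  simp only [hG.partialTranspose_localPart]
  rw [(hG.isTracelessHermitian_localPart _).traceNorm_signedSum (ε := hL.commForm A₂)
    (t := fun g => transposeSignOn A₂ (pauliLabel (g.1 : QOp Q))) (hL.commForm_self A₂) fun g h =>
      (congrArg _ (hL.labelHom.map_mul g h)).trans (transposeSignOn_mul A₂ _ _)]
  rw [Real.logb, Real.log_sqrt (Nat.cast_nonneg _), Real.logb, div_right_comm]

end IsStabilizerState

end StabilizerState

section CanonicalGenerators

open scoped IsMulCommutative

variable {Q : Type*} [Fintype Q] [DecidableEq Q] {G : Subgroup (QOp Q)ˣ} {S : Finset Q} {r s : ℕ}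

namespace IsStabilizerGroup

theorem isCanonicalGenerators_iff (hG : IsStabilizerGroup G) {z : Fin r → G}
    {v : Fin s ⊕ Fin s → G} :
    IsCanonicalGenerators S G (fun i => (z i).1) (fun j => (v (.inl j)).1)
        (fun j => (v (.inr j)).1) ↔
      Subgroup.closure (Set.range z ∪ Set.range v) = ⊤ ∧ Nat.card G = 2 ^ (r + 2 * s) ∧
      (∀ i, ∀ g ∈ Set.range z ∪ Set.range v, hG.commForm S (z i) g = 1) ∧
      ∀ i, ∀ g ∈ Set.range z ∪ Set.range v, hG.commForm S (v i) g = 1 ↔ g ≠ v i.swap := by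
  have himage : Set.range (fun i => (z i).1) ∪ Set.range (fun j => (v (.inl j)).1) ∪
      Set.range (fun j => (v (.inr j)).1) = G.subtype '' (Set.range z ∪ Set.range v) := by
    rw [Set.image_union, ← Set.range_comp, ← Set.range_comp, ← Sum.elim_comp_inl_inr (_ ∘ v),
      Set.Sum.elim_range, Set.union_assoc]
    rfl
  have hclosure : Subgroup.closure (G.subtype '' (Set.range z ∪ Set.range v)) = G ↔
      Subgroup.closure (Set.range z ∪ Set.range v) = ⊤ := by
    rw [← MonoidHom.map_closure, ← (Subgroup.map_injective G.subtype_injective).eq_iff,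
      ← MonoidHom.range_eq_map, Subgroup.range_subtype]
  refine Iff.trans ⟨fun h => And.intro h.generate (And.intro h.independent (And.intro h.z_comm
    (And.intro h.w_comm h.wbar_comm))), fun h => ⟨h.1, h.2.1, h.2.2.1, h.2.2.2.1, h.2.2.2.2⟩⟩ ?_
  simp only [himage, hclosure, Set.forall_mem_image, Subgroup.subtype_apply,
    hG.commute_pauliRestrict_iff, Sum.forall, Sum.swap_inl, Sum.swap_inr, ne_eq, Subtype.coe_inj]

theorem exists_isCanonicalGenerators (hG : IsStabilizerGroup G) (S : Finset Q) :
    ∃ (r s : ℕ) (z : Fin r → (QOp Q)ˣ) (w wbar : Fin s → (QOp Q)ˣ),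
      IsCanonicalGenerators S G z w wbar := by
  have := hG.finite
  have hε := hG.commForm_self S
  obtain ⟨s, v, hv, hmax⟩ := exists_isHyperbolic_ker_le hε
  have := hG.isMulCommutative
  have hpow (g : (hG.commForm S).ker) : g ^ 2 = 1 := Subtype.ext (hG.pow_two_eq_one g)
  obtain ⟨r, z, hz, hr⟩ := exists_closure_range_eq_top_of_pow_eq_one hpow
  refine ⟨r, s, _, _, _, (hG.isCanonicalGenerators_iff (z := fun i => z i) (v := v)).2
    ⟨?_, ?_, fun i g _ => ?_, fun i g hg => hv.eq_one_iff hε ?_ i⟩⟩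
  · have hclosure := congrArg (Subgroup.map (hG.commForm S).ker.subtype) hz
    rw [MonoidHom.map_closure, ← Set.range_comp, ← MonoidHom.range_eq_map,
      Subgroup.range_subtype] at hclosure
    rw [Subgroup.closure_union, sup_comm, ← hv.closure_sup_ker hmax]
    exact congrArg (_ ⊔ ·) hclosure
  · rw [← (hG.commForm S).ker.card_mul_index, ← IsHyperbolic.ker_signPairing_eq hε hmax,
      hv.index_ker_signPairing, IsHyperbolic.ker_signPairing_eq hε hmax, hr, Fintype.card_fin,
      pow_add]
  · rw [MonoidHom.mem_ker.1 (z i).2, MonoidHom.one_apply]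
  · exact hg.imp_left (Set.range_subset_iff.2 (fun i => (z i).2) ·)

end IsStabilizerGroup

namespace IsCanonicalGenerators

theorem index_ker_commForm {z : Fin r → (QOp Q)ˣ} {w wbar : Fin s → (QOp Q)ˣ}
    (h : IsCanonicalGenerators S G z w wbar) (hG : IsStabilizerGroup G) :
    (hG.commForm S).ker.index = 2 ^ (2 * s) := by
  have hε := hG.commForm_self S
  have hmem : ∀ g ∈ Set.range z ∪ Set.range w ∪ Set.range wbar, g ∈ G := fun g hg =>
    h.generate.le (Subgroup.subset_closure hg)
  lift z to Fin r → G using fun i => hmem _ (.inl (.inl ⟨i, rfl⟩))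
  lift w to Fin s → G using fun j => hmem _ (.inl (.inr ⟨j, rfl⟩))
  lift wbar to Fin s → G using fun j => hmem _ (.inr ⟨j, rfl⟩)
  let v := Sum.elim w wbar
  obtain ⟨hgen, hcard, hz, hv⟩ := (hG.isCanonicalGenerators_iff (v := v)).1 h
  have := hG.isMulCommutative
  have hinj : Function.Injective (Sum.elim z v) :=
    injective_of_closure_range_eq_top_of_card hG.pow_two_eq_one
      (by rwa [Set.Sum.elim_range]) (by simp [hcard, two_mul])
  have hhyp : IsHyperbolic (hG.commForm S) v := fun i j => by
    rw [hv i _ (.inr ⟨j, rfl⟩), (Sum.elim_injective.1 hinj).2.1.ne_iff]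
  have hzk k i : hG.commForm S (z i) k = 1 :=
    closure_le_ker_signForm hε (fun g hg => (signForm_symm hε _ _).trans (hz i g hg))
      (hgen ▸ Subgroup.mem_top k)
  have hmax : (signPairing (hG.commForm S) v).ker ≤ (hG.commForm S).ker := fun k hk => by
    have horth : ∀ x ∈ Set.range z ∪ Set.range v, hG.commForm S x k = 1 :=
      Set.union_subset (Set.range_subset_iff.2 (hzk k))
        (Set.range_subset_iff.2 (mem_ker_signPairing.1 hk))
    exact MonoidHom.ext fun g => closure_le_ker_signForm hε horth (hgen ▸ Subgroup.mem_top g)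
  rw [← IsHyperbolic.ker_signPairing_eq hε hmax, hhyp.index_ker_signPairing, Fintype.card_fin]

end IsCanonicalGenerators

end CanonicalGenerators

section CrossSubgroup

open scoped IsMulCommutative

variable {Q : Type*} [Fintype Q] [DecidableEq Q] {G : Subgroup (QOp Q)ˣ} {A₁ A₂ : Finset Q}

namespace IsStabilizerGroup

theorem localStabilizers_mono (hG : IsStabilizerGroup G) : Monotone (localStabilizers G) :=
  fun _ _ h g hg => by
    have hgG := localStabilizers_le G _ hg
    rw [hG.mem_localStabilizers_iff hgG] at hg ⊢
    exact fun q hq => hg q (mt (@h q) hq)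

theorem localStabilizers_sup_le (hG : IsStabilizerGroup G) (A₁ A₂ : Finset Q) :
    localStabilizers G A₁ ⊔ localStabilizers G A₂ ≤ localStabilizers G (A₁ ∪ A₂) :=
  hG.localStabilizers_mono.le_map_sup A₁ A₂

theorem disjoint_localStabilizers (hG : IsStabilizerGroup G) (hA : Disjoint A₁ A₂) :
    Disjoint (localStabilizers G A₁) (localStabilizers G A₂) := by
  refine Subgroup.disjoint_def.2 fun {g} h₁ h₂ => ?_
  have hg := localStabilizers_le G _ h₁
  rw [hG.mem_localStabilizers_iff hg] at h₁ h₂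
  have hlabel : hG.labelHom ⟨g, hg⟩ = hG.labelHom 1 := by
    rw [map_one]
    funext q
    by_cases hq : q ∈ A₁
    · exact h₂ q (Finset.disjoint_left.1 hA hq)
    · exact h₁ q hq
  exact congrArg Subtype.val (hG.labelHom_injective hlabel)

theorem commForm_univ (hG : IsStabilizerGroup G) : hG.commForm Finset.univ = 1 := by
  ext1 g
  ext1 h
  refine (hG.commute_pauliRestrict_iff _ g h).1 ?_
  have hcomm : Commute (g.1 : QOp Q) (h.1 : QOp Q) :=
    congrArg Units.val (hG.comm g g.2 h h.2)
  simp only [pauliRestrict, Finset.mem_univ, if_true]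
  rcases hG.eqUpToSign g with hg | hg
  · rwa [hg] at hcomm
  · rwa [hg, Commute.neg_left_iff] at hcomm

theorem commForm_inter (hG : IsStabilizerGroup G) {S : Finset Q} {g : G}
    (hg : g.1 ∈ localStabilizers G S) (T : Finset Q) :
    hG.commForm (S ∩ T) g = hG.commForm T g := by
  rw [hG.mem_localStabilizers_iff g.2] at hg
  ext1 h
  simp only [commForm_apply, commSignOn_apply]
  refine Finset.prod_subset Finset.inter_subset_right fun q hq hqS => ?_
  rw [hg q fun h => hqS (Finset.mem_inter.2 ⟨h, hq⟩), Pauli.commSign_one_left]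

theorem localStabilizers_sup_le_ker_commForm (hG : IsStabilizerGroup G) (hA : Disjoint A₁ A₂) :
    localStabilizers G A₁ ⊔ localStabilizers G A₂ ≤ (hG.commForm A₂).ker.map G.subtype := by
  have hmem {S : Finset Q} (hS : ∀ g : G, g.1 ∈ localStabilizers G S → hG.commForm A₂ g = 1) :
      localStabilizers G S ≤ (hG.commForm A₂).ker.map G.subtype := fun g hg =>
    ⟨⟨g, localStabilizers_le G S hg⟩, hS _ hg, rfl⟩
  refine sup_le (hmem fun g hg => ?_) (hmem fun g hg => ?_)
  · rw [← hG.commForm_inter hg, Finset.disjoint_iff_inter_eq_empty.1 hA]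
    rfl
  · rw [← Finset.inter_univ A₂, hG.commForm_inter hg, hG.commForm_univ, MonoidHom.one_apply]

theorem index_ker_commForm_eq_of_sup_eq (hG : IsStabilizerGroup G) {S : Finset Q}
    {K H L : Subgroup (QOp Q)ˣ} (hLG : L ≤ G) (hHG : H ≤ G)
    (hK : K ≤ (hG.commForm S).ker.map G.subtype) (hsup : K ⊔ H = L) :
    ((hG.mono hLG).commForm S).ker.index = ((hG.mono hHG).commForm S).ker.index := by
  have hHL : H ≤ L := le_sup_right.trans hsup.le
  have hKL : K ≤ L := le_sup_left.trans hsup.le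
  have hker : K.subgroupOf L ≤ ((hG.mono hLG).commForm S).ker := fun k hk => by
    obtain ⟨g, hg, hgk⟩ := hK hk
    obtain rfl : g = ⟨k, hLG k.2⟩ := Subtype.ext hgk
    exact MonoidHom.ext fun h => DFunLike.congr_fun hg (⟨h, hLG h.2⟩ : G)
  have htop : K.subgroupOf L ⊔ H.subgroupOf L = ⊤ := by
    rw [← Subgroup.subgroupOf_sup hKL hHL, hsup, Subgroup.subgroupOf_self]
  refine (index_ker_compl₂_comp ((hG.mono hLG).commForm_self S) (f := Subgroup.inclusion hHL)
    (top_le_iff.1 ?_)).symm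
  rw [Subgroup.inclusion_range, ← htop]
  exact sup_le_sup_right hker _

theorem exists_isCrossSubgroup (hG : IsStabilizerGroup G) (A₁ A₂ : Finset Q) :
    ∃ G₁₂, IsCrossSubgroup G A₁ A₂ G₁₂ := by
  have hL := hG.mono (localStabilizers_le G (A₁ ∪ A₂))
  have := hL.isMulCommutative
  obtain ⟨G₁₂, hdisj, hsup⟩ :=
    exists_disjoint_sup_eq_of_pow_eq_one hL.pow_two_eq_one (hG.localStabilizers_sup_le A₁ A₂)
  exact ⟨G₁₂, hsup, hdisj⟩

end IsStabilizerGroup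

namespace IsCrossSubgroup

variable {G₁₂ : Subgroup (QOp Q)ˣ} {ψ : QBasis Q → ℂ}

theorem le (hc : IsCrossSubgroup G A₁ A₂ G₁₂) : G₁₂ ≤ G :=
  (le_sup_right.trans hc.generate.le).trans (localStabilizers_le G _)

theorem card_localStabilizers_union (hc : IsCrossSubgroup G A₁ A₂ G₁₂) (hG : IsStabilizerGroup G)
    (hA : Disjoint A₁ A₂) :
    Nat.card (localStabilizers G (A₁ ∪ A₂)) =
      Nat.card (localStabilizers G A₁) * Nat.card (localStabilizers G A₂) * Nat.card G₁₂ := by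
  have hcomm {H K : Subgroup (QOp Q)ˣ} (hH : H ≤ G) (hK : K ≤ G) :
      ∀ a ∈ H, ∀ b ∈ K, Commute a b := fun a ha b hb => hG.comm a (hH ha) b (hK hb)
  have h₁ := localStabilizers_le G A₁
  have h₂ := localStabilizers_le G A₂
  rw [← hc.generate, card_sup_of_disjoint (hcomm (sup_le h₁ h₂) hc.le) hc.independent,
    card_sup_of_disjoint (hcomm h₁ h₂) (hG.disjoint_localStabilizers hA)]

theorem mutualInfo_eq (hc : IsCrossSubgroup G A₁ A₂ G₁₂) (hG : IsStabilizerGroup G)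
    (hψ : IsStabilizerState G ψ) (hA : Disjoint A₁ A₂) (m : ℝ) :
    mutualInfo m A₁ A₂ ψ = Real.logb 2 (Nat.card G₁₂) := by
  have hcard {H : Subgroup (QOp Q)ˣ} (hH : H ≤ G) : (Nat.card H : ℝ) ≠ 0 :=
    have := (hG.mono hH).finite
    Nat.cast_ne_zero.2 Nat.card_pos.ne'
  have h₁ := hcard (localStabilizers_le G A₁)
  have h₂ := hcard (localStabilizers_le G A₂)
  rw [mutualInfo, hψ.renyiEntropy_eq hG, hψ.renyiEntropy_eq hG, hψ.renyiEntropy_eq hG,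
    hc.card_localStabilizers_union hG hA, Finset.card_union_of_disjoint hA]
  push_cast
  rw [Real.logb_mul (mul_ne_zero h₁ h₂) (hcard hc.le), Real.logb_mul h₁ h₂]
  ring

theorem ptNegativity_eq (hc : IsCrossSubgroup G A₁ A₂ G₁₂) (hG : IsStabilizerGroup G)
    (hψ : IsStabilizerState G ψ) (hA : Disjoint A₁ A₂) : ptNegativity A₁ A₂ ψ =
      Real.logb 2 ((hG.mono hc.le).commForm A₂).ker.index / 2 := by
  rw [hψ.ptNegativity_eq hG, hG.index_ker_commForm_eq_of_sup_eq (localStabilizers_le G _) hc.le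
    (hG.localStabilizers_sup_le_ker_commForm hA) hc.generate]

end IsCrossSubgroup

end CrossSubgroup

theorem theorem3_general {Q : Type*} [Fintype Q] [DecidableEq Q]
    (G : Subgroup (QOp Q)ˣ) (hG : IsStabilizerGroup G)
    (ψ : QBasis Q → ℂ) (hψ : IsStabilizerState G ψ)
    (A₁ A₂ : Finset Q) (hA : Disjoint A₁ A₂) :
    (∃ G₁₂ : Subgroup (QOp Q)ˣ, IsCrossSubgroup G A₁ A₂ G₁₂) ∧
    (∀ G₁₂ : Subgroup (QOp Q)ˣ, IsCrossSubgroup G A₁ A₂ G₁₂ →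
      ∃ (r s : ℕ) (z : Fin r → (QOp Q)ˣ) (w wbar : Fin s → (QOp Q)ˣ),
        IsCanonicalGenerators A₂ G₁₂ z w wbar) ∧
    (∀ (G₁₂ : Subgroup (QOp Q)ˣ) (r s : ℕ)
      (z : Fin r → (QOp Q)ˣ) (w wbar : Fin s → (QOp Q)ˣ),
      IsCrossSubgroup G A₁ A₂ G₁₂ → IsCanonicalGenerators A₂ G₁₂ z w wbar →
      ptNegativity A₁ A₂ ψ = s ∧
      ∀ m : ℝ, (s : ℝ) = (mutualInfo m A₁ A₂ ψ - r) / 2) := by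
  refine ⟨hG.exists_isCrossSubgroup A₁ A₂,
    fun G₁₂ hc => (hG.mono hc.le).exists_isCanonicalGenerators A₂,
    fun G₁₂ r s z w wbar hc hcan => ⟨?_, fun m => ?_⟩⟩
  · rw [hc.ptNegativity_eq hG hψ hA, hcan.index_ker_commForm (hG.mono hc.le)]
    simp [Real.logb_pow]
  · rw [hc.mutualInfo_eq hG hψ hA, hcan.independent]
    simp [Real.logb_pow]

theorem theorem3 {Q : Type*} [Fintype Q] [DecidableEq Q]
    (G : Subgroup (QOp Q)ˣ) (hG : IsStabilizerGroup G)
    (ψ : QBasis Q → ℂ) (hψ : IsStabilizerState G ψ)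
    (A₁ A₂ : Finset Q) (hA : Disjoint A₁ A₂) :
    (∃ G₁₂ : Subgroup (QOp Q)ˣ, IsCrossSubgroup G A₁ A₂ G₁₂) ∧
    (∀ G₁₂ : Subgroup (QOp Q)ˣ, IsCrossSubgroup G A₁ A₂ G₁₂ →
      ∃ (r s : ℕ) (z : Fin r → (QOp Q)ˣ) (w wbar : Fin s → (QOp Q)ˣ),
        IsCanonicalGenerators A₂ G₁₂ z w wbar) ∧
    (∀ (G₁₂ : Subgroup (QOp Q)ˣ) (r s : ℕ)
      (z : Fin r → (QOp Q)ˣ) (w wbar : Fin s → (QOp Q)ˣ),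
      IsCrossSubgroup G A₁ A₂ G₁₂ → IsCanonicalGenerators A₂ G₁₂ z w wbar →
      ptNegativity A₁ A₂ ψ = s ∧
      ∀ m : ℝ, 0 ≤ m → (s : ℝ) = (mutualInfo m A₁ A₂ ψ - r) / 2) := by
  obtain ⟨hcross, hcanonical, heq⟩ := theorem3_general G hG ψ hψ A₁ A₂ hA
  exact ⟨hcross, hcanonical, fun G₁₂ r s z w wbar hc hcan =>
    (heq G₁₂ r s z w wbar hc hcan).imp_right fun h m _ => h m⟩
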